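/- Let $(V,E)$ be a finite directed multigraph that is strongly connected (for all $u,v\in V$ there is a directed path from $u$ to $v$), and write $E_{uv}$ for the set of edges from $u$ to $v$. For each $v\in V$ let $S_v$ be a complete metric space with at least two points, and for each $e\in E_{uv}$ let $f_e\colon S_v\to S_u$ be a map satisfying $$ r'_e\, d(x,y)\;\le\; d\big(f_e(x),f_e(y)\big)\;\le\; r_e\, d(x,y)\qquad\text{for all } x,y\in S_v, $$ where $r'_e>0$ and $r_e<1$. Let $(K_v)_{v\in V}$ be the attractor list, i.e. nonempty compact sets $K_v\subseteq S_v$ with $K_u=\bigcup_{v\in V}\bigcup_{e\in E_{uv}} f_e[K_v]$ for all $u\in V$. Suppose the strong open set condition holds: there are open sets $U_v\subseteq S_v$ such that (a) $f_e[U_v]\subseteq U_u$ for all $u,v\in V$ and $e\in E_{uv}$; (b) $f_e[U_v]\cap f_{e'}[U_{v'}]=\varnothing$ for all $u,v,v'\in V$, $e\in E_{uv}$, $e'\in E_{uv'}$ with $e\ne e'$; (c) $U_v\cap K_v\ne\varnothing$ for all $v\in V$. For $s\ge 0$ let $M'(s)$ be the $V\times V$ matrix with entries $M'_{uv}(s)=\sum_{e\in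 E_{uv}} (r'_e)^s$, let $\rho$ denote the spectral radius (the maximum absolute value of the complex eigenvalues), and let $s_2\ge 0$ be the dimension of the Mauldin–Williams graph $(V,E,(r'_e))$, i.e. the solution of $\rho(M'(s_2))=1$. Then the Hausdorff dimensions of the attractors satisfy $$ \dim_{\mathrm H} K_v\ge s_2\qquad\text{for all } v\in V. $$ -/

import Mathlib

/-!
Graph-directed iterated function systems. The directed multigraph is a `Quiver` on `V`: the type
`u ⟶ v` is the set `E_{uv}` of edges from `u` to `v`, and the map attached to an edge
`e : u ⟶ v` goes from the space `S v` to the space `S u`.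
-/

namespace GraphIFS

universe u w x

/-- The matrix `M(s)` of a Mauldin–Williams graph with ratios `r`:
its `(u, v)` entry is the sum of `r_e ^ s` over the edges `e` from `u` to `v`. -/
noncomputable def mwMatrix {V : Type u} [Quiver.{w} V] [∀ a b : V, Fintype (a ⟶ b)]
    (r : ∀ ⦃a b : V⦄, (a ⟶ b) → ℝ) (s : ℝ) : Matrix V V ℝ :=
  Matrix.of fun a b => ∑ e : (a ⟶ b), r e ^ s

/-- `Φ(s) = ρ(M(s))`, the maximum absolute value of the complex eigenvalues of `M(s)`. -/
noncomputable def mwRadius {V : Type u} [Fintype V] [DecidableEq V] [Quiver.{w} V]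
    [∀ a b : V, Fintype (a ⟶ b)] (r : ∀ ⦃a b : V⦄, (a ⟶ b) → ℝ) (s : ℝ) : ENNReal :=
  spectralRadius ℂ ((mwMatrix r s).map (fun t : ℝ => (t : ℂ)))

/-- `s` is the dimension of the Mauldin–Williams graph with ratios `r`:
it is the solution `s ≥ 0` of `ρ(M(s)) = 1`. -/
def IsMWDimension {V : Type u} [Fintype V] [DecidableEq V] [Quiver.{w} V]
    [∀ a b : V, Fintype (a ⟶ b)] (r : ∀ ⦃a b : V⦄, (a ⟶ b) → ℝ) (s : ℝ) : Prop :=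
  0 ≤ s ∧ mwRadius r s = 1

/-- `K` is the attractor list of the system `f`: nonempty compact sets with
`K_a = ⋃_b ⋃_{e ∈ E_{ab}} f_e[K_b]` for every vertex `a`. -/
structure IsAttractorList {V : Type u} [Quiver.{w} V] {S : V → Type x}
    [∀ v, MetricSpace (S v)] (f : ∀ ⦃a b : V⦄, (a ⟶ b) → S b → S a)
    (K : ∀ v, Set (S v)) : Prop where
  nonempty : ∀ v, (K v).Nonempty
  isCompact : ∀ v, IsCompact (K v)
  invariant : ∀ a, K a = ⋃ b : V, ⋃ e : (a ⟶ b), f e '' K b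

/-- The strong open set condition for the system `f` with attractor list `K`. Two edges leaving
the same vertex `a`, with possibly different terminal vertices, are compared as elements of
`Σ b, (a ⟶ b)`. -/
def StrongOpenSetCondition {V : Type u} [Quiver.{w} V] {S : V → Type x}
    [∀ v, MetricSpace (S v)] (f : ∀ ⦃a b : V⦄, (a ⟶ b) → S b → S a)
    (K : ∀ v, Set (S v)) : Prop :=
  ∃ U : ∀ v, Set (S v),
    (∀ v, IsOpen (U v)) ∧
    (∀ (a b : V) (e : a ⟶ b), f e '' U b ⊆ U a) ∧
    (∀ (a b b' : V) (e : a ⟶ b) (e' : a ⟶ b'),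
      (⟨b, e⟩ : Σ c : V, (a ⟶ c)) ≠ ⟨b', e'⟩ → Disjoint (f e '' U b) (f e' '' U b')) ∧
    (∀ v, (U v ∩ K v).Nonempty)

end GraphIFS

open scoped ENNReal NNReal Topology
open Metric Set Filter

/-! Fix `0 < d < s₂`. Some entry `(a, b)` of `M'(s₂) ^ n` is at least `1 / |V|`, since the norm
dominates the spectral radius. Path ratios decay at least geometrically, so lowering the exponent to
`d` makes the sum over length-`n` paths `a → b` as large as desired
(`IsMWDimension.exists_finset_path`). Strong connectivity closes these paths into loops at `v`, at a
cost bounded independently of `n`. Each loop ends with a loop `σ` sending `K v` into `U v`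
(`IsAttractorList.exists_loop_mapsTo`), so the open set condition makes the images of `K v` disjoint
(`eq_of_pathMap_eq`). Disjoint compact images are `δ`-separated, and a pigeonhole induction on
finite covers then gives positive `d`-dimensional Hausdorff measure. No measure is built on the
attractor. -/

/-! ### Finite covers and Hausdorff measure -/

/-- If the maps `g i` expand distances on `K` by at least `ρ i`, have `δ`-separated images of `K`
inside `K`, and `1 ≤ ∑ ρ i ^ s`, then every finite cover of `K` has `s`-dimensional size at least
`δ ^ s`. -/
theorem rpow_le_sum_ediam_rpow_of_subset_iUnion {X ι κ : Type*} [PseudoEMetricSpace X] [Fintype ι]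
    [Nontrivial ι] {K : Set X} (hK : K.Nonempty) {g : ι → X → X} {ρ : ι → ℝ≥0∞} {δ : ℝ≥0∞} {s : ℝ}
    (hs : 0 ≤ s) (hmaps : ∀ i, MapsTo (g i) K K)
    (hexp : ∀ i, ∀ x ∈ K, ∀ y ∈ K, ρ i * edist x y ≤ edist (g i x) (g i y))
    (hsep : ∀ i j, i ≠ j → ∀ x ∈ K, ∀ y ∈ K, δ ≤ edist (g i x) (g j y))
    (hsum : 1 ≤ ∑ i, ρ i ^ s) (J : Finset κ) (A : κ → Set X) (hA : K ⊆ ⋃ j ∈ J, A j) :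
    δ ^ s ≤ ∑ j ∈ J, ediam (A j) ^ s := by
  classical
  induction J using Finset.strongInduction generalizing A with
  | H J ih =>
    by_cases hbig : ∃ j ∈ J, δ ≤ ediam (A j)
    · obtain ⟨j, hj, hδ⟩ := hbig
      exact (ENNReal.rpow_le_rpow hδ hs).trans
        (Finset.single_le_sum (f := fun j => ediam (A j) ^ s) (fun _ _ => zero_le) hj)
    · push Not at hbig
      -- Every cover set now has diameter below `δ`, so it meets at most one image `g i '' K`.
      let T : ι → Finset κ := fun i => J.filter fun j => (A j ∩ g i '' K).Nonempty
      have hdisj : ∀ i i', i ≠ i' → Disjoint (T i) (T i') := by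
        intro i i' hne
        rw [Finset.disjoint_left]
        intro j hj hj'
        obtain ⟨hjJ, _, hx, x, hxK, rfl⟩ := Finset.mem_filter.1 hj
        obtain ⟨_, _, hy, y, hyK, rfl⟩ := Finset.mem_filter.1 hj'
        exact (hbig j hjJ).not_ge
          ((hsep i i' hne x hxK y hyK).trans (edist_le_ediam_of_mem hx hy))
      have hcov : ∀ i, K ⊆ ⋃ j ∈ T i, (g i ⁻¹' A j ∩ K) := by
        intro i x hx
        obtain ⟨j, hj, hxj⟩ := mem_iUnion₂.1 (hA (hmaps i hx))
        exact mem_iUnion₂.2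
          ⟨j, Finset.mem_filter.2 ⟨hj, _, hxj, mem_image_of_mem _ hx⟩, hxj, hx⟩
      have hne : ∀ i, (T i).Nonempty := by
        intro i
        obtain ⟨x, hx⟩ := hK
        obtain ⟨j, hj, -⟩ := mem_iUnion₂.1 (hcov i hx)
        exact ⟨j, hj⟩
      -- A second index `i'` claims a cover set outside `T i`, so the induction descends.
      have hlt : ∀ i, T i ⊂ J := by
        intro i
        refine (Finset.filter_subset _ _).ssubset_of_ne fun h => ?_
        obtain ⟨i', hi'⟩ := exists_ne i
        obtain ⟨j, hj⟩ := hne i'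
        refine Finset.disjoint_left.1 (hdisj i' i hi') hj ?_
        have hjJ : j ∈ J := Finset.filter_subset _ _ hj
        rwa [← h] at hjJ
      -- Pull the sets of `T i` back by `g i`: this covers `K`, and expansion bounds the new
      -- diameters.
      have hstep : ∀ i, ρ i ^ s * δ ^ s ≤ ∑ j ∈ T i, ediam (A j) ^ s := by
        intro i
        refine (mul_le_mul_right (ih _ (hlt i) _ (hcov i)) _).trans ?_
        rw [Finset.mul_sum]
        refine Finset.sum_le_sum fun j _ => ?_
        rw [← ENNReal.mul_rpow_of_nonneg _ _ hs]
        refine ENNReal.rpow_le_rpow ?_ hs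
        simp only [ediam, ENNReal.mul_iSup]
        refine iSup₂_le fun x hx => iSup₂_le fun y hy => ?_
        exact (hexp i x hx.2 y hy.2).trans (edist_le_ediam_of_mem hx.1 hy.1)
      calc δ ^ s ≤ (∑ i, ρ i ^ s) * δ ^ s := le_mul_of_one_le_left (zero_le) hsum
        _ ≤ ∑ i, ∑ j ∈ T i, ediam (A j) ^ s := by
          rw [Finset.sum_mul]; exact Finset.sum_le_sum fun i _ => hstep i
        _ = ∑ j ∈ Finset.univ.biUnion T, ediam (A j) ^ s :=
          (Finset.sum_biUnion fun i _ i' _ h => hdisj i i' h).symm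
        _ ≤ ∑ j ∈ J, ediam (A j) ^ s :=
          Finset.sum_le_sum_of_subset
            (Finset.biUnion_subset.2 fun i _ => Finset.filter_subset _ _)

/-- A set of finite diameter has open neighbourhoods of almost the same `s`-dimensional size. -/
theorem exists_isOpen_ediam_rpow_le {X : Type*} [PseudoEMetricSpace X] (t : Set X) {s : ℝ}
    (hs : 0 < s) {η : ℝ≥0∞} (hη : η ≠ 0) :
    ∃ O, IsOpen O ∧ t ⊆ O ∧ ediam O ^ s ≤ ediam t ^ s + η := by
  by_cases htop : ediam t = ∞
  · exact ⟨univ, isOpen_univ, subset_univ _, by simp [htop, ENNReal.top_rpow_of_pos hs]⟩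
  have hfin : ediam t ^ s ≠ ∞ := ENNReal.rpow_ne_top_of_nonneg hs.le htop
  have hcont : Tendsto (fun ε : ℝ≥0 => (ediam t + 2 * (ε : ℝ≥0∞)) ^ s) (𝓝 0)
      (𝓝 (ediam t ^ s)) := by
    have h : Continuous fun ε : ℝ≥0 => (ediam t + 2 * (ε : ℝ≥0∞)) ^ s :=
      ENNReal.continuous_rpow_const.comp
        (continuous_const.add ((ENNReal.continuous_const_mul (by simp)).comp
          ENNReal.continuous_coe))
    simpa using h.tendsto 0
  have hev := (hcont.eventually_lt_const (ENNReal.lt_add_right hfin hη)).filter_mono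
    (nhdsWithin_le_nhds (s := Ioi 0))
  obtain ⟨ε, hε, hε0⟩ := (hev.and self_mem_nhdsWithin).exists
  refine ⟨thickening ε t, isOpen_thickening, self_subset_thickening (by exact_mod_cast hε0) _, ?_⟩
  exact (ENNReal.rpow_le_rpow (ediam_thickening_le ε) hs.le).trans hε.le

/-- A lower bound on the `s`-dimensional size of all finite covers of a compact set bounds its
Hausdorff measure from below. -/
theorem IsCompact.le_hausdorffMeasure_of_forall_finset {X : Type*} [EMetricSpace X]
    [MeasurableSpace X] [BorelSpace X] {K : Set X} (hK : IsCompact K) {s : ℝ} (hs : 0 < s)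
    {c : ℝ≥0∞} (h : ∀ (J : Finset ℕ) (A : ℕ → Set X), K ⊆ ⋃ j ∈ J, A j →
      c ≤ ∑ j ∈ J, ediam (A j) ^ s) :
    c ≤ MeasureTheory.Measure.hausdorffMeasure s K := by
  rw [MeasureTheory.Measure.hausdorffMeasure_apply]
  -- The scale `1` is arbitrary: the bound holds for covers of any mesh.
  refine le_iSup₂_of_le 1 one_pos (le_iInf₂ fun t ht => le_iInf fun _ => ?_)
  refine ENNReal.le_of_forall_pos_le_add fun ε hε _ => ?_
  obtain ⟨η, hη, hηsum⟩ := ENNReal.exists_pos_sum_of_countable' (ε := (ε : ℝ≥0∞))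
    (by exact_mod_cast hε.ne') ℕ
  choose O hO htO hdiam using fun n => exists_isOpen_ediam_rpow_le (t n) hs (hη n).ne'
  obtain ⟨J, hJ⟩ := hK.elim_finite_subcover O hO (ht.trans (iUnion_mono htO))
  have hterm : ∀ n, ediam (t n) ^ s ≤ ⨆ _ : (t n).Nonempty, ediam (t n) ^ s := by
    intro n
    rcases (t n).eq_empty_or_nonempty with h0 | h1
    · simp [h0, ENNReal.zero_rpow_of_pos hs]
    · simp [h1]
  calc c ≤ ∑ j ∈ J, ediam (O j) ^ s := h J O hJ
    _ ≤ ∑ j ∈ J, ((⨆ _ : (t j).Nonempty, ediam (t j) ^ s) + η j) :=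
      Finset.sum_le_sum fun j _ => (hdiam j).trans (add_le_add_left (hterm j) _)
    _ ≤ ∑' j, ((⨆ _ : (t j).Nonempty, ediam (t j) ^ s) + η j) := ENNReal.sum_le_tsum _
    _ ≤ _ := by rw [ENNReal.tsum_add]; exact add_le_add_right hηsum.le _

/-- Finitely many compact sets that are pairwise disjoint are uniformly separated. -/
theorem exists_pos_forall_le_edist_of_pairwise_disjoint {X ι : Type*} [EMetricSpace X] [Finite ι]
    {C : ι → Set X} (hC : ∀ i, IsCompact (C i)) (hdisj : ∀ i j, i ≠ j → Disjoint (C i) (C j)) :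
    ∃ δ : ℝ≥0, 0 < δ ∧ ∀ i j, i ≠ j → ∀ x ∈ C i, ∀ y ∈ C j, (δ : ℝ≥0∞) ≤ edist x y := by
  have hev : ∀ᶠ δ : ℝ≥0 in 𝓝[>] 0,
      ∀ i j, i ≠ j → ∀ x ∈ C i, ∀ y ∈ C j, (δ : ℝ≥0∞) ≤ edist x y := by
    refine eventually_all.2 fun i => eventually_all.2 fun j => ?_
    by_cases hij : i = j
    · simp [hij]
    obtain ⟨ε, hε, h⟩ := exists_pos_forall_lt_edist (hC i) (hC j).isClosed (hdisj i j hij)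
    filter_upwards [Ioo_mem_nhdsGT hε] with δ hδ _ x hx y hy
    exact le_trans (by exact_mod_cast hδ.2.le) (h x hx y hy).le
  obtain ⟨δ, h, hδ⟩ := (hev.and self_mem_nhdsWithin).exists
  exact ⟨δ, hδ, h⟩

/-- Lower bound for the Hausdorff dimension of a compact set containing pairwise disjoint images
of itself under finitely many maps with lower Lipschitz constants `ρ i`. -/
theorem IsCompact.le_dimH_of_pairwise_disjoint_image {X ι : Type*} [MetricSpace X] [Fintype ι]
    {K : Set X} (hK : IsCompact K) (hne : K.Nonempty) {g : ι → X → X} {ρ : ι → ℝ} {s : ℝ≥0}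
    (hs : 0 < s) (hcont : ∀ i, Continuous (g i)) (hmaps : ∀ i, MapsTo (g i) K K)
    (hρ : ∀ i, 0 ≤ ρ i) (hρ1 : ∀ i, ρ i ≤ 1)
    (hexp : ∀ i x y, ρ i * dist x y ≤ dist (g i x) (g i y))
    (hdisj : ∀ i j, i ≠ j → Disjoint (g i '' K) (g j '' K))
    (hsum : 1 < ∑ i, ρ i ^ (s : ℝ)) : (s : ℝ≥0∞) ≤ dimH K := by
  have hs' : (0 : ℝ) < s := hs
  have : Nontrivial ι := by
    rw [← Fintype.one_lt_card_iff_nontrivial]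
    have h : ∑ i, ρ i ^ (s : ℝ) ≤ ∑ _i : ι, (1 : ℝ) :=
      Finset.sum_le_sum fun i _ => Real.rpow_le_one (hρ i) (hρ1 i) hs'.le
    simp only [Finset.sum_const, Finset.card_univ, nsmul_eq_mul, mul_one] at h
    exact_mod_cast hsum.trans_le h
  obtain ⟨δ, hδ, hsep⟩ := exists_pos_forall_le_edist_of_pairwise_disjoint
    (fun i => hK.image (hcont i)) hdisj
  borelize X
  refine le_dimH_of_hausdorffMeasure_ne_zero (ne_of_gt ?_)
  refine lt_of_lt_of_le (ENNReal.rpow_pos (p := s) (ENNReal.coe_pos.2 hδ) ENNReal.coe_ne_top)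
    (hK.le_hausdorffMeasure_of_forall_finset hs' fun J A hA =>
      rpow_le_sum_ediam_rpow_of_subset_iUnion (ρ := fun i => ENNReal.ofReal (ρ i)) hne hs'.le hmaps
        ?_ ?_ ?_ J A hA)
  · intro i x _ y _
    rw [edist_dist, edist_dist, ← ENNReal.ofReal_mul (hρ i)]
    exact ENNReal.ofReal_le_ofReal (hexp i x y)
  · intro i j hij x hx y hy
    exact hsep i j hij _ (mem_image_of_mem _ hx) _ (mem_image_of_mem _ hy)
  · simp_rw [ENNReal.ofReal_rpow_of_nonneg (hρ _) hs'.le]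
    rw [← ENNReal.ofReal_sum_of_nonneg fun i _ => Real.rpow_nonneg (hρ i) _]
    exact ENNReal.one_le_ofReal.2 hsum.le

open scoped Matrix.Norms.Operator in
/-- Every power of a real matrix of complex spectral radius `1` has a large entry. -/
theorem Matrix.exists_inv_card_le_abs_pow_apply {V : Type*} [Fintype V] [DecidableEq V] [Nonempty V]
    (M : Matrix V V ℝ) (h : spectralRadius ℂ (M.map fun t : ℝ => (t : ℂ)) = 1) (n : ℕ) :
    ∃ a b, (Fintype.card V : ℝ)⁻¹ ≤ |(M ^ n) a b| := by
  have : CompleteSpace (Matrix V V ℂ) := FiniteDimensional.complete ℂ _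
  set A : Matrix V V ℂ := M.map fun t : ℝ => (t : ℂ)
  have hpow : A ^ n = (M ^ n).map Complex.ofRealHom :=
    (Matrix.map_pow M Complex.ofRealHom n).symm
  have hnorm : 1 ≤ ‖A ^ n‖₊ := by
    have h1 := (spectrum.spectralRadius_pow_le' A n).trans
      (spectrum.spectralRadius_le_nnnorm (𝕜 := ℂ) (A ^ n))
    rw [h, one_pow] at h1
    exact_mod_cast h1
  by_contra! hlt
  have hcard : (0 : ℝ) < Fintype.card V := by exact_mod_cast Fintype.card_pos
  -- This norm is the largest absolute row sum, below `1` if all entries are below `1 / |V|`.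
  rw [Matrix.linfty_opNNNorm_def] at hnorm
  refine hnorm.not_gt ((Finset.sup_lt_iff (by simp)).2 fun a _ => ?_)
  rw [← NNReal.coe_lt_coe, NNReal.coe_sum]
  calc ∑ b, (‖(A ^ n) a b‖₊ : ℝ) < ∑ _b : V, (Fintype.card V : ℝ)⁻¹ := by
        refine Finset.sum_lt_sum_of_nonempty Finset.univ_nonempty fun b _ => ?_
        simpa [hpow] using hlt a b
    _ = 1 := by simp [hcard.ne']
namespace GraphIFS

open Quiver

universe u w x

/-! ### Maps and ratios along paths -/

section Paths

variable {V : Type u} [Quiver.{w} V] {S : V → Type x}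

/-- The composition `f_{e₁} ∘ ⋯ ∘ f_{eₙ}` of the maps along a path `e₁ ⋯ eₙ`. -/
def pathMap (f : ∀ ⦃a b : V⦄, (a ⟶ b) → S b → S a) {a : V} : ∀ {b : V}, Path a b → S b → S a
  | _, .nil => id
  | _, .cons p e => pathMap f p ∘ f e

/-- The product of the ratios along a path. -/
def pathRatio (r : ∀ ⦃a b : V⦄, (a ⟶ b) → ℝ) {a : V} : ∀ {b : V}, Path a b → ℝ
  | _, .nil => 1
  | _, .cons p e => pathRatio r p * r e

theorem pathMap_comp (f : ∀ ⦃a b : V⦄, (a ⟶ b) → S b → S a) {a b c : V} (p : Path a b)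
    (q : Path b c) (y : S c) : pathMap f (p.comp q) y = pathMap f p (pathMap f q y) := by
  induction q with
  | nil => rfl
  | cons q e ih => exact ih (f e y)

theorem pathRatio_comp (r : ∀ ⦃a b : V⦄, (a ⟶ b) → ℝ) {a b c : V} (p : Path a b)
    (q : Path b c) : pathRatio r (p.comp q) = pathRatio r p * pathRatio r q := by
  induction q with
  | nil => exact (mul_one _).symm
  | cons q e ih => rw [Path.comp_cons, pathRatio, pathRatio, ih, mul_assoc]

theorem pathRatio_pos {r : ∀ ⦃a b : V⦄, (a ⟶ b) → ℝ} (hr : ∀ (a b : V) (e : a ⟶ b), 0 < r e)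
    {a b : V} (p : Path a b) : 0 < pathRatio r p := by
  induction p with
  | nil => exact one_pos
  | cons p e ih => exact mul_pos ih (hr _ _ e)

theorem pathRatio_le_pow {r : ∀ ⦃a b : V⦄, (a ⟶ b) → ℝ} (hr : ∀ (a b : V) (e : a ⟶ b), 0 < r e)
    {R : ℝ} (hR : ∀ (a b : V) (e : a ⟶ b), r e ≤ R) {a b : V} (p : Path a b) :
    pathRatio r p ≤ R ^ p.length := by
  induction p with
  | nil => exact le_rfl
  | cons p e ih =>
    rw [pathRatio, Path.length_cons, pow_succ]
    exact mul_le_mul ih (hR _ _ e) (hr _ _ e).le ((pathRatio_pos hr p).le.trans ih)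

theorem mapsTo_pathMap {f : ∀ ⦃a b : V⦄, (a ⟶ b) → S b → S a} {W : ∀ v, Set (S v)}
    (hW : ∀ (a b : V) (e : a ⟶ b), f e '' W b ⊆ W a) {a b : V} (p : Path a b) :
    MapsTo (pathMap f p) (W b) (W a) := by
  induction p with
  | nil => exact mapsTo_id _
  | cons p e ih => exact ih.comp (mapsTo_iff_image_subset.2 (hW _ _ e))

/-- Under the open set condition, a path of given length is determined by any point of the
corresponding image of the open set at its endpoint. -/
theorem eq_of_pathMap_eq {f : ∀ ⦃a b : V⦄, (a ⟶ b) → S b → S a} {U : ∀ v, Set (S v)}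
    (hU : ∀ (a b : V) (e : a ⟶ b), f e '' U b ⊆ U a)
    (hdisj : ∀ (a b b' : V) (e : a ⟶ b) (e' : a ⟶ b'),
      (⟨b, e⟩ : Σ c : V, (a ⟶ c)) ≠ ⟨b', e'⟩ → Disjoint (f e '' U b) (f e' '' U b'))
    (hinj : ∀ ⦃a b : V⦄ (p : Path a b), Function.Injective (pathMap f p))
    {a b b' : V} (p : Path a b) (q : Path a b') (hlen : p.length = q.length)
    {x : S b} {y : S b'} (hx : x ∈ U b) (hy : y ∈ U b') (hxy : pathMap f p x = pathMap f q y) :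
    (⟨b, p⟩ : Σ c : V, Path a c) = ⟨b', q⟩ := by
  induction p generalizing b' with
  | nil =>
    cases q with
    | nil => rfl
    | cons q e => simp at hlen
  | cons p e ih =>
    cases q with
    | nil => simp at hlen
    | cons q e' =>
      -- The prefixes agree by induction, as the last edges keep the points in `U`; injectivity then
      -- cancels the prefix and leaves two edges to compare.
      have hpq := ih q (by simpa using hlen) (hU _ _ e (mem_image_of_mem _ hx))
        (hU _ _ e' (mem_image_of_mem _ hy)) hxy
      cases hpq
      have he := hinj p hxy
      by_contra hne
      refine disjoint_left.1 (hdisj _ _ _ e e' fun h => hne ?_) (mem_image_of_mem _ hx)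
        (he ▸ mem_image_of_mem _ hy)
      cases h
      rfl

variable [∀ v, MetricSpace (S v)] {f : ∀ ⦃a b : V⦄, (a ⟶ b) → S b → S a}

theorem pathRatio_mul_dist_le {r : ∀ ⦃a b : V⦄, (a ⟶ b) → ℝ}
    (hr : ∀ (a b : V) (e : a ⟶ b), 0 < r e)
    (hlower : ∀ (a b : V) (e : a ⟶ b) (x y : S b), r e * dist x y ≤ dist (f e x) (f e y))
    {a b : V} (p : Path a b) (x y : S b) :
    pathRatio r p * dist x y ≤ dist (pathMap f p x) (pathMap f p y) := by
  induction p with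
  | nil => exact (one_mul _).le
  | cons p e ih =>
    rw [pathRatio, mul_assoc]
    exact (mul_le_mul_of_nonneg_left (hlower _ _ e x y) (pathRatio_pos hr p).le).trans (ih _ _)

theorem injective_pathMap {r : ∀ ⦃a b : V⦄, (a ⟶ b) → ℝ}
    (hr : ∀ (a b : V) (e : a ⟶ b), 0 < r e)
    (hlower : ∀ (a b : V) (e : a ⟶ b) (x y : S b), r e * dist x y ≤ dist (f e x) (f e y))
    {a b : V} (p : Path a b) : Function.Injective (pathMap f p) := by
  intro x y hxy
  have h := pathRatio_mul_dist_le hr hlower p x y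
  rw [hxy, dist_self] at h
  exact dist_le_zero.1 (nonpos_of_mul_nonpos_right h (pathRatio_pos hr p))

theorem dist_pathMap_le {R : ℝ} (hR0 : 0 ≤ R)
    (hR : ∀ (a b : V) (e : a ⟶ b) (x y : S b), dist (f e x) (f e y) ≤ R * dist x y)
    {a b : V} (p : Path a b) (x y : S b) :
    dist (pathMap f p x) (pathMap f p y) ≤ R ^ p.length * dist x y := by
  induction p with
  | nil => exact (one_mul _).ge
  | cons p e ih =>
    rw [Path.length_cons, pow_succ, mul_assoc]
    exact (ih _ _).trans (mul_le_mul_of_nonneg_left (hR _ _ e x y) (pow_nonneg hR0 _))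

theorem continuous_pathMap {R : ℝ} (hR0 : 0 ≤ R)
    (hR : ∀ (a b : V) (e : a ⟶ b) (x y : S b), dist (f e x) (f e y) ≤ R * dist x y)
    {a b : V} (p : Path a b) : Continuous (pathMap f p) :=
  (LipschitzWith.of_dist_le_mul (K := ⟨R ^ p.length, pow_nonneg hR0 _⟩)
    fun x y => dist_pathMap_le hR0 hR p x y).continuous

theorem IsAttractorList.image_subset {K : ∀ v, Set (S v)} (hK : IsAttractorList f K) (a b : V)
    (e : a ⟶ b) : f e '' K b ⊆ K a := by
  rw [hK.invariant a]
  exact subset_iUnion₂ (s := fun b (e : a ⟶ b) => f e '' K b) b e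

theorem IsAttractorList.exists_path {K : ∀ v, Set (S v)} (hK : IsAttractorList f K) {a : V}
    {x : S a} (hx : x ∈ K a) (n : ℕ) :
    ∃ (b : V) (p : Path a b), p.length = n ∧ ∃ y ∈ K b, pathMap f p y = x := by
  induction n with
  | zero => exact ⟨a, .nil, rfl, x, hx, rfl⟩
  | succ n ih =>
    obtain ⟨b, p, hp, y, hy, rfl⟩ := ih
    rw [hK.invariant b] at hy
    obtain ⟨c, e, z, hz, rfl⟩ := mem_iUnion₂.1 hy
    exact ⟨c, p.cons e, by simp [hp], z, hz, rfl⟩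

/-- Some loop at `v` maps the attractor into a given open set that meets it. -/
theorem IsAttractorList.exists_loop_mapsTo [Finite V] (hconn : IsStronglyConnected V)
    {K : ∀ v, Set (S v)} (hK : IsAttractorList f K) {R : ℝ} (hR0 : 0 ≤ R) (hR1 : R < 1)
    (hR : ∀ (a b : V) (e : a ⟶ b) (x y : S b), dist (f e x) (f e y) ≤ R * dist x y)
    {v : V} {O : Set (S v)} (hO : IsOpen O) (hOK : (O ∩ K v).Nonempty) :
    ∃ p : Path v v, MapsTo (pathMap f p) (K v) O := by
  obtain ⟨x, hxO, hxK⟩ := hOK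
  obtain ⟨ε, hε, hball⟩ := Metric.isOpen_iff.1 hO x hxO
  have : Nonempty V := ⟨v⟩
  obtain ⟨c, hc⟩ := Finite.exists_max fun v => diam (K v)
  obtain ⟨n, hn⟩ := ((tendsto_pow_atTop_nhds_zero_of_lt_one hR0 hR1).mul_const (diam (K c))
    |>.eventually_lt_const (by simpa using hε)).exists
  -- The piece of the attractor along `p` contains the chosen point and has diameter below `ε`; `q`
  -- only returns to `v`.
  obtain ⟨b, p, hp, y, hy, rfl⟩ := hK.exists_path hxK n
  obtain ⟨q⟩ := hconn b v
  refine ⟨p.comp q, fun z hz => hball ?_⟩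
  rw [pathMap_comp, mem_ball]
  have hqz := mapsTo_pathMap hK.image_subset q hz
  calc dist (pathMap f p (pathMap f q z)) (pathMap f p y)
      ≤ R ^ p.length * dist (pathMap f q z) y := dist_pathMap_le hR0 hR p _ _
    _ ≤ R ^ n * diam (K c) := by
      rw [hp]
      exact mul_le_mul_of_nonneg_left
        ((dist_le_diam_of_mem (hK.isCompact b).isBounded hqz hy).trans (hc b))
        (pow_nonneg hR0 _)
    _ < ε := hn

end Paths

/-! ### Path sums and the Mauldin–Williams matrix -/

/-- The entries of the powers of `M(s)` are sums over paths. -/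
theorem exists_finset_path_sum_eq {V : Type u} [Fintype V] [DecidableEq V] [Quiver.{w} V]
    [∀ a b : V, Fintype (a ⟶ b)] {r : ∀ ⦃a b : V⦄, (a ⟶ b) → ℝ}
    (hr : ∀ (a b : V) (e : a ⟶ b), 0 < r e) (s : ℝ) (n : ℕ) (a b : V) :
    ∃ T : Finset (Path a b), (∀ p ∈ T, p.length = n) ∧
      ∑ p ∈ T, pathRatio r p ^ s = (mwMatrix r s ^ n) a b := by
  induction n generalizing b with
  | zero =>
    by_cases hab : a = b
    · subst hab
      exact ⟨{.nil}, by simp, by simp [pathRatio]⟩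
    · exact ⟨∅, by simp, by simp [hab]⟩
  | succ n ih =>
    choose T hT hsum using ih
    let φ : (Σ c : V, Path a c × (c ⟶ b)) ↪ Path a b :=
      ⟨fun q => q.2.1.cons q.2.2, by
        rintro ⟨c, p, e⟩ ⟨c', p', e'⟩ h
        obtain rfl : c = c' := Path.obj_eq_of_cons_eq_cons h
        obtain rfl : p = p' := eq_of_heq (Path.heq_of_cons_eq_cons h)
        obtain rfl : e = e' := eq_of_heq (Path.hom_heq_of_cons_eq_cons h)
        rfl⟩
    refine ⟨(Finset.univ.sigma fun c => T c ×ˢ Finset.univ).map φ, ?_, ?_⟩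
    · intro p hp
      obtain ⟨⟨c, p, e⟩, hq, rfl⟩ := Finset.mem_map.1 hp
      simp only [Finset.mem_sigma, Finset.mem_univ, Finset.mem_product, true_and, and_true] at hq
      exact congrArg (· + 1) (hT c p hq)
    · rw [Finset.sum_map, Finset.sum_sigma, pow_succ, Matrix.mul_apply]
      refine Finset.sum_congr rfl fun c _ => ?_
      rw [Finset.sum_product, ← hsum c, Finset.sum_mul]
      refine Finset.sum_congr rfl fun p _ => ?_
      rw [mwMatrix, Matrix.of_apply, Finset.mul_sum]
      refine Finset.sum_congr rfl fun e _ => ?_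
      exact Real.mul_rpow (pathRatio_pos hr p).le (hr _ _ e).le

/-- Finitely many numbers below `1` are bounded by a common positive number below `1`. -/
theorem exists_ratio_bound {V : Type u} [Finite V] [Quiver.{w} V] [∀ a b : V, Finite (a ⟶ b)]
    {r : ∀ ⦃a b : V⦄, (a ⟶ b) → ℝ} (hr : ∀ (a b : V) (e : a ⟶ b), r e < 1) :
    ∃ R : ℝ, 0 < R ∧ R < 1 ∧ ∀ (a b : V) (e : a ⟶ b), r e ≤ R := by
  have hev : ∀ᶠ R : ℝ in 𝓝[<] 1, ∀ (a b : V) (e : a ⟶ b), r e ≤ R :=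
    eventually_all.2 fun a => eventually_all.2 fun b => eventually_all.2 fun e => by
      filter_upwards [Ioo_mem_nhdsLT (hr a b e)] with R hR using hR.1.le
  obtain ⟨R, hR, hR'⟩ := (hev.and (Ioo_mem_nhdsLT (zero_lt_one (α := ℝ)))).exists
  exact ⟨R, hR'.1, hR'.2, hR⟩

/-- Below the dimension of the Mauldin–Williams graph, the sums over the paths of a fixed length
between suitable vertices are arbitrarily large. -/
theorem IsMWDimension.exists_finset_path {V : Type u} [Fintype V] [DecidableEq V] [Nonempty V]
    [Quiver.{w} V] [∀ a b : V, Fintype (a ⟶ b)] {r : ∀ ⦃a b : V⦄, (a ⟶ b) → ℝ}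
    (hr : ∀ (a b : V) (e : a ⟶ b), 0 < r e) {R : ℝ} (hR0 : 0 < R) (hR1 : R < 1)
    (hR : ∀ (a b : V) (e : a ⟶ b), r e ≤ R) {t : ℝ} (ht : IsMWDimension r t) {s : ℝ} (hst : s < t)
    (C : ℝ) :
    ∃ (n : ℕ) (a b : V) (T : Finset (Path a b)), (∀ p ∈ T, p.length = n) ∧
      C < ∑ p ∈ T, pathRatio r p ^ s := by
  have hcard : (0 : ℝ) < Fintype.card V := by exact_mod_cast Fintype.card_pos
  have hgrow : 1 < R ^ (s - t) := Real.one_lt_rpow_of_pos_of_lt_one_of_neg hR0 hR1 (by linarith)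
  obtain ⟨n, hn⟩ := pow_unbounded_of_one_lt (C * Fintype.card V) hgrow
  obtain ⟨a, b, hab⟩ := (mwMatrix r t).exists_inv_card_le_abs_pow_apply ht.2 n
  obtain ⟨T, hT, hsum⟩ := exists_finset_path_sum_eq hr t n a b
  refine ⟨n, a, b, T, hT, ?_⟩
  rw [← hsum, abs_of_nonneg
    (Finset.sum_nonneg fun p _ => Real.rpow_nonneg (pathRatio_pos hr p).le _)] at hab
  calc C < (R ^ (s - t)) ^ n * (Fintype.card V : ℝ)⁻¹ := by
        rwa [← div_eq_mul_inv, lt_div_iff₀ hcard]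
    _ ≤ (R ^ (s - t)) ^ n * ∑ p ∈ T, pathRatio r p ^ t := by gcongr
    _ ≤ ∑ p ∈ T, pathRatio r p ^ s := by
      rw [Finset.mul_sum]
      refine Finset.sum_le_sum fun p hp => ?_
      have hpos := pathRatio_pos hr p
      -- The exponent `s - t` is negative, so the bound `R ^ n` on ratios reverses.
      have hle : (R ^ (s - t)) ^ n ≤ pathRatio r p ^ (s - t) := by
        rw [← Real.rpow_natCast, ← Real.rpow_mul hR0.le, mul_comm, Real.rpow_mul hR0.le,
          Real.rpow_natCast, ← hT p hp]
        exact Real.rpow_le_rpow_of_nonpos hpos (pathRatio_le_pow hr hR p) (by linarith)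
      calc (R ^ (s - t)) ^ n * pathRatio r p ^ t
          ≤ pathRatio r p ^ (s - t) * pathRatio r p ^ t := by gcongr
        _ = pathRatio r p ^ s := by rw [← Real.rpow_add hpos]; simp

end GraphIFS

/-! ### The dimension bound -/

open GraphIFS

theorem theorem3p14 {V : Type*} [Fintype V] [DecidableEq V] [Quiver V]
    [∀ a b : V, Fintype (a ⟶ b)] (hconn : Quiver.IsStronglyConnected V)
    {S : V → Type*} [∀ v, MetricSpace (S v)] [∀ v, CompleteSpace (S v)] [∀ v, Nontrivial (S v)]
    (f : ∀ ⦃a b : V⦄, (a ⟶ b) → S b → S a)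
    (r r' : ∀ ⦃a b : V⦄, (a ⟶ b) → ℝ)
    (hr : ∀ (a b : V) (e : a ⟶ b), r e < 1)
    (hr' : ∀ (a b : V) (e : a ⟶ b), 0 < r' e)
    (hupper : ∀ (a b : V) (e : a ⟶ b) (x y : S b), dist (f e x) (f e y) ≤ r e * dist x y)
    (hlower : ∀ (a b : V) (e : a ⟶ b) (x y : S b), r' e * dist x y ≤ dist (f e x) (f e y))
    (K : ∀ v, Set (S v)) (hK : GraphIFS.IsAttractorList f K)
    (hU : GraphIFS.StrongOpenSetCondition f K)
    (s₂ : ℝ) (hs₂ : GraphIFS.IsMWDimension r' s₂) :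
    ∀ v, ENNReal.ofReal s₂ ≤ dimH (K v) := by
  intro v
  have : Nonempty V := ⟨v⟩
  obtain ⟨R, hR0, hR1, hrR⟩ := exists_ratio_bound hr
  have hR : ∀ (a b : V) (e : a ⟶ b) (x y : S b), dist (f e x) (f e y) ≤ R * dist x y :=
    fun a b e x y => (hupper a b e x y).trans (by gcongr; exact hrR a b e)
  -- Two distinct points are needed to compare the lower and upper ratios.
  have hR' : ∀ (a b : V) (e : a ⟶ b), r' e ≤ R := by
    intro a b e
    obtain ⟨x, y, hxy⟩ := exists_pair_ne (S b)
    exact le_of_mul_le_mul_right ((hlower a b e x y).trans (hR a b e x y)) (dist_pos.2 hxy)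
  have hinj : ∀ ⦃a b : V⦄ (p : Quiver.Path a b), Function.Injective (pathMap f p) :=
    fun _ _ p => injective_pathMap hr' hlower p
  obtain ⟨U, hUo, hUmaps, hUdisj, hUK⟩ := hU
  obtain ⟨σ, hσ⟩ := hK.exists_loop_mapsTo hconn hR0.le hR1 hR (hUo v) (hUK v)
  refine le_of_forall_lt_imp_le_of_dense fun d hd => ?_
  lift d to ℝ≥0 using (hd.trans ENNReal.ofReal_lt_top).ne
  rcases eq_zero_or_pos d with rfl | hd0
  · simp
  have hds : (d : ℝ) < s₂ := by
    rw [← ENNReal.ofReal_coe_nnreal] at hd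
    exact (ENNReal.ofReal_lt_ofReal_iff_of_nonneg d.coe_nonneg).1 hd
  let P : ∀ a, Quiver.Path v a := fun a => (hconn v a).some
  let Q : ∀ b, Quiver.Path b v := fun b => (hconn b v).some
  let W : V × V → ℝ := fun ab =>
    pathRatio r' (P ab.1) * (pathRatio r' (Q ab.2) * pathRatio r' σ)
  have hWpos : ∀ ab, 0 < W ab := fun ab =>
    mul_pos (pathRatio_pos hr' _) (mul_pos (pathRatio_pos hr' _) (pathRatio_pos hr' _))
  -- The minimal closing factor fixes the required path sum before `n`, `a`, `b` are known.
  obtain ⟨ab₀, hab₀⟩ := Finite.exists_min W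
  obtain ⟨n, a, b, T, hT, hsum⟩ :=
    hs₂.exists_finset_path hr' hR0 hR1 hR' hds ((W ab₀ ^ (d : ℝ))⁻¹)
  let loop : T → Quiver.Path v v := fun p => (P a).comp (p.1.comp ((Q b).comp σ))
  have hratio : ∀ p : T, pathRatio r' (loop p) = W (a, b) * pathRatio r' p.1 := by
    intro p
    simp only [loop, W, pathRatio_comp]
    ring
  refine (hK.isCompact v).le_dimH_of_pairwise_disjoint_image (hK.nonempty v)
    (g := fun p : T => pathMap f (loop p)) (ρ := fun p => pathRatio r' (loop p)) hd0
    (fun p => continuous_pathMap hR0.le hR _) (fun p => mapsTo_pathMap hK.image_subset _)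
    (fun p => (pathRatio_pos hr' _).le)
    (fun p => (pathRatio_le_pow hr' hR' _).trans (pow_le_one₀ hR0.le hR1.le))
    (fun p => pathRatio_mul_dist_le hr' hlower _) ?_ ?_
  · intro p q hpq
    rw [disjoint_left]
    rintro _ ⟨x, hx, rfl⟩ ⟨y, hy, hxy⟩
    simp only [loop, pathMap_comp] at hxy
    -- After cancelling `P a`, both arguments lie in `U b`: `σ` enters `U v` and `Q b` stays in the
    -- open sets.
    have h := eq_of_pathMap_eq hUmaps hUdisj hinj q.1 p.1 ((hT _ q.2).trans (hT _ p.2).symm)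
      (mapsTo_pathMap hUmaps (Q b) (hσ hy)) (mapsTo_pathMap hUmaps (Q b) (hσ hx))
      (hinj (P a) hxy)
    exact hpq (Subtype.ext (eq_of_heq (Sigma.mk.inj h).2).symm)
  · have hW0 : 0 < W ab₀ ^ (d : ℝ) := Real.rpow_pos_of_pos (hWpos _) _
    have hWle : W ab₀ ^ (d : ℝ) ≤ W (a, b) ^ (d : ℝ) :=
      Real.rpow_le_rpow (hWpos _).le (hab₀ _) d.coe_nonneg
    calc (1 : ℝ) = W ab₀ ^ (d : ℝ) * (W ab₀ ^ (d : ℝ))⁻¹ := (mul_inv_cancel₀ hW0.ne').symm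
      _ < W ab₀ ^ (d : ℝ) * ∑ p ∈ T, pathRatio r' p ^ (d : ℝ) := by gcongr
      _ ≤ W (a, b) ^ (d : ℝ) * ∑ p ∈ T, pathRatio r' p ^ (d : ℝ) :=
        mul_le_mul_of_nonneg_right hWle
          (Finset.sum_nonneg fun p _ => Real.rpow_nonneg (pathRatio_pos hr' p).le _)
      _ = ∑ p : T, pathRatio r' (loop p) ^ (d : ℝ) := by
        rw [Finset.mul_sum, ← Finset.sum_coe_sort]
        refine Finset.sum_congr rfl fun p _ => ?_
        rw [hratio, Real.mul_rpow (hWpos _).le (pathRatio_pos hr' _).le]
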